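/- Let $p$ be a prime and let $s, m, n$ be positive integers with $n \ge 2m$. For $R=\mathbb{Z}/p^t\mathbb{Z}$ with $t\ge 1$, call vectors $\alpha_1,\dots,\alpha_k\in R^n$ unimodular if the $k\times n$ matrix with rows $\alpha_1,\dots,\alpha_k$ has a right inverse. A $k$-subspace of $R^n$ is an $R$-submodule having a basis of $k$ vectors that is unimodular, and the dimension of an arbitrary $R$-submodule $V\subseteq R^n$ is the largest number of vectors of $V$ that form a unimodular set. The Grassmann graph $G_{p^t}(n,m)$ has as vertices the $m$-subspaces of $R^n$, two of them being adjacent when their intersection has dimension $m-1$. Let $\alpha(G)$ denote the independence number of a graph $G$ (the largest cardinality of a set of pairwise non-adjacent vertices), and let ${n\brack m}_p=\prod_{i=1}^m \frac{p^{n+1-i}-1}{p^i-1}$ be the Gaussian binomial coefficient. Then $$p^{(s-1)(m-1)(n-m)}\,\alpha\big(G_p(n,m)\big)\;\le\;\alpha\big(G_{p^s}(n,m)\big)\;\le\; p^{(s-1)(m-1)(n-m)}\,\frac{{n\brack m}_p}{{n-m+1\brack 1}_p}.$$ -/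

import Mathlib

namespace GrassmannRing

/-- A family of `k` row vectors in `R^n` is unimodular if the `k × n` matrix with these rows
has a right inverse. -/
def IsUnimodular {R : Type*} [CommRing R] {n k : ℕ} (a : Fin k → Fin n → R) : Prop :=
  ∃ B : Matrix (Fin n) (Fin k) R, Matrix.of a * B = 1

/-- The dimension of a linear subset `V` of `R^n`: the largest number of vectors in a unimodular
family of vectors of `V`. -/
noncomputable def dim {R : Type*} [CommRing R] {n : ℕ} (V : Submodule R (Fin n → R)) : ℕ :=
  sSup {k : ℕ | ∃ a : Fin k → Fin n → R, (∀ i, a i ∈ V) ∧ IsUnimodular a}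

/-- A linear subset of `R^n` is a `k`-subspace if it has a basis of `k` vectors
that is unimodular. -/
def IsSubspace {R : Type*} [CommRing R] {n : ℕ} (k : ℕ) (X : Submodule R (Fin n → R)) : Prop :=
  ∃ a : Fin k → Fin n → R,
    LinearIndependent R a ∧ Submodule.span R (Set.range a) = X ∧ IsUnimodular a

/-- The Grassmann graph over `R`: its vertices are the `m`-subspaces of `R^n`, and two (distinct)
vertices are adjacent when the dimension of their intersection is `m - 1`. -/
def grassmannGraph (R : Type*) [CommRing R] (n m : ℕ) :
    SimpleGraph {X : Submodule R (Fin n → R) // IsSubspace m X} where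
  Adj X Y := X ≠ Y ∧ dim (X.1 ⊓ Y.1) + 1 = m
  symm := ⟨fun X Y h => ⟨h.1.symm, by rw [inf_comm]; exact h.2⟩⟩
  loopless := ⟨fun _ h => h.1 rfl⟩

/-- The Gaussian binomial coefficient `[n choose m]_q`, for `m ≤ n` and `2 ≤ q`. -/
def gaussBinom (q n m : ℕ) : ℚ :=
  ∏ i ∈ Finset.Icc 1 m, ((q : ℚ) ^ (n + 1 - i) - 1) / ((q : ℚ) ^ i - 1)

end GrassmannRing

namespace GrassmannRing

open Matrix

set_option linter.unusedSectionVars false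

/-! ### Matrices with a right inverse -/

/-! Write m = k + 1 and n = m + N. Two m-subspaces are equal or adjacent exactly when they share a
unimodular family of k vectors (`eq_or_adj_iff`).

Upper bound: all m-subspaces contain equally many unimodular k-families, and distinct members of an
independent set share none. Counting these families in R^m and in R^n gives the quotient
(`indepNum_mul_card_le`, `card_hasRightInverse`).

Lower bound (`card_ker_pow_mul_indepNum_le`): each member of a maximum independent set over the
residue field is lifted to the row spaces of A + P B, where A lifts a basis matrix, B lifts a basis
of a complement, and P runs over a code of |ker φ|^(kN) matrices with entries in ker φ. A unimodular
k-family shared by lifts of distinct members would reduce to one shared by the members themselves.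
Between lifts of one member it is excluded by the code (`exists_code`), built from multiplication in
a field extension of degree N; this needs m ≤ N, that is n ≥ 2m. -/

/-- A (not necessarily square) matrix has a right inverse. -/
def HasRightInverse {R : Type*} [CommRing R] {ι κ : Type*} [Fintype κ] [DecidableEq ι]
    (A : Matrix ι κ R) : Prop :=
  ∃ B : Matrix κ ι R, A * B = 1

section Ring

variable {R : Type*} [CommRing R] {ι κ l : Type*} [Fintype ι] [Fintype κ] [DecidableEq ι]
  [DecidableEq l]

theorem HasRightInverse.mul_right_cancel {A : Matrix ι κ R} (hA : HasRightInverse A)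
    {X Y : Matrix l ι R} (h : X * A = Y * A) : X = Y := by
  obtain ⟨B, hB⟩ := hA
  calc X = X * A * B := by rw [Matrix.mul_assoc, hB, Matrix.mul_one]
    _ = Y := by rw [h, Matrix.mul_assoc, hB, Matrix.mul_one]

theorem HasRightInverse.of_mul {X : Matrix l ι R} {A : Matrix ι κ R}
    (h : HasRightInverse (X * A)) : HasRightInverse X := by
  obtain ⟨B, hB⟩ := h
  exact ⟨A * B, by rw [← Matrix.mul_assoc, hB]⟩

theorem HasRightInverse.mul [Fintype l] {X : Matrix l ι R} {A : Matrix ι κ R}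
    (hX : HasRightInverse X) (hA : HasRightInverse A) : HasRightInverse (X * A) := by
  obtain ⟨B, hB⟩ := hA
  obtain ⟨C, hC⟩ := hX
  exact ⟨B * C, by rw [Matrix.mul_assoc, ← Matrix.mul_assoc A, hB, Matrix.one_mul, hC]⟩

theorem HasRightInverse.map {S : Type*} [CommRing S] (f : R →+* S) {A : Matrix ι κ R}
    (hA : HasRightInverse A) : HasRightInverse (A.map f) := by
  obtain ⟨B, hB⟩ := hA
  refine ⟨B.map f, ?_⟩
  rw [← Matrix.map_mul, hB]
  exact Matrix.map_one f (map_zero f) (map_one f)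

theorem HasRightInverse.submatrix {A : Matrix ι κ R} (hA : HasRightInverse A) {f : l → ι}
    (hf : Function.Injective f) : HasRightInverse (A.submatrix f id) := by
  obtain ⟨B, hB⟩ := hA
  refine ⟨B.submatrix id f, ?_⟩
  rw [← Matrix.submatrix_mul A B f id f Function.bijective_id, hB, Matrix.submatrix_one _ hf]

theorem HasRightInverse.linearIndependent {A : Matrix ι κ R} (hA : HasRightInverse A) :
    LinearIndependent R A.row := by
  rw [← Matrix.vecMul_injective_iff]
  obtain ⟨B, hB⟩ := hA
  intro x y h
  have h' : x ᵥ* A = y ᵥ* A := h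
  calc x = (x ᵥ* A) ᵥ* B := by rw [Matrix.vecMul_vecMul, hB, Matrix.vecMul_one]
    _ = y := by rw [h', Matrix.vecMul_vecMul, hB, Matrix.vecMul_one]

theorem hasRightInverse_iff_linearIndependent {K : Type*} [Field K] {A : Matrix ι κ K} :
    HasRightInverse A ↔ LinearIndependent K A.row := by
  classical
  refine ⟨HasRightInverse.linearIndependent, fun h => ?_⟩
  obtain ⟨g, hg⟩ := LinearMap.exists_leftInverse_of_injective A.vecMulLinear
    (LinearMap.ker_eq_bot.2 (Matrix.vecMul_injective_iff.2 h))
  refine ⟨(LinearMap.toMatrix' g)ᵀ, ?_⟩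
  ext i j
  have h1 := congrArg (fun f => f (Pi.single i 1) j) hg
  simp only [LinearMap.comp_apply, Matrix.vecMulLinear_apply, Matrix.single_one_vecMul,
    LinearMap.id_apply] at h1
  rw [← LinearMap.toMatrix'_mulVec] at h1
  rw [Matrix.mul_apply, Matrix.one_apply]
  simp only [Matrix.mulVec, dotProduct, Pi.single_apply, Matrix.row] at h1
  rw [show (if i = j then (1 : K) else 0) = if j = i then 1 else 0 by simp [eq_comm], ← h1]
  exact Finset.sum_congr rfl fun x _ => by rw [Matrix.transpose_apply, mul_comm]

theorem mem_range_vecMulLinear_iff {A : Matrix ι κ R} {X : Matrix l κ R} :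
    (∀ i, X i ∈ LinearMap.range A.vecMulLinear) ↔ ∃ C : Matrix l ι R, C * A = X := by
  constructor
  · intro h
    choose C hC using h
    refine ⟨Matrix.of C, ?_⟩
    ext i j
    exact congrFun (hC i) j
  · rintro ⟨C, rfl⟩ i
    exact ⟨C i, by ext j; rfl⟩

theorem range_vecMulLinear_mul_le [Fintype l] (C : Matrix l ι R) (A : Matrix ι κ R) :
    LinearMap.range (C * A).vecMulLinear ≤ LinearMap.range A.vecMulLinear := by
  rintro _ ⟨x, rfl⟩
  exact ⟨x ᵥ* C, by simp [Matrix.vecMul_vecMul]⟩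

/-- A square matrix factor of a matrix with a right inverse does not change the row space. -/
theorem range_vecMulLinear_mul {C : Matrix ι ι R} {A : Matrix ι κ R}
    (h : HasRightInverse (C * A)) :
    LinearMap.range (C * A).vecMulLinear = LinearMap.range A.vecMulLinear := by
  refine le_antisymm (range_vecMulLinear_mul_le C A) ?_
  obtain ⟨D, hD⟩ := h.of_mul
  have : D * (C * A) = A := by rw [← Matrix.mul_assoc, mul_eq_one_comm.1 hD, Matrix.one_mul]
  conv_lhs => rw [← this]
  exact range_vecMulLinear_mul_le D _

theorem isSubspace_iff {n k : ℕ} {X : Submodule R (Fin n → R)} :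
    IsSubspace k X ↔ ∃ A : Matrix (Fin k) (Fin n) R, HasRightInverse A ∧
      LinearMap.range A.vecMulLinear = X := by
  constructor
  · rintro ⟨a, -, h, hu⟩
    exact ⟨Matrix.of a, hu, by rw [_root_.range_vecMulLinear, ← h]; rfl⟩
  · rintro ⟨A, hA, h⟩
    exact ⟨A, hA.linearIndependent, by rw [← h, _root_.range_vecMulLinear]; rfl, hA⟩

theorem IsUnimodular.le [Nontrivial R] {n k : ℕ} {a : Fin k → Fin n → R}
    (h : IsUnimodular a) : k ≤ n := by
  simpa using (HasRightInverse.linearIndependent h).fintype_card_le_finrank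

theorem IsUnimodular.castLE {n k j : ℕ} (hj : j ≤ k) {a : Fin k → Fin n → R}
    (h : IsUnimodular a) : IsUnimodular fun i => a (Fin.castLE hj i) :=
  HasRightInverse.submatrix h (Fin.castLE_injective hj)

/-! ### Adjacency in the Grassmann graph -/

theorem bddAbove_unimodular_card [Nontrivial R] {n : ℕ} (V : Submodule R (Fin n → R)) :
    BddAbove {k : ℕ | ∃ a : Fin k → Fin n → R, (∀ i, a i ∈ V) ∧ IsUnimodular a} :=
  ⟨n, fun _ ⟨_, _, h⟩ => h.le⟩

theorem exists_isUnimodular_dim [Nontrivial R] {n : ℕ} (V : Submodule R (Fin n → R)) :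
    ∃ a : Fin (dim V) → Fin n → R, (∀ i, a i ∈ V) ∧ IsUnimodular a :=
  Nat.sSup_mem (s := {k : ℕ | ∃ a : Fin k → Fin n → R, (∀ i, a i ∈ V) ∧ IsUnimodular a})
    ⟨0, Fin.elim0, fun i => i.elim0, 0, by ext i; exact i.elim0⟩ (bddAbove_unimodular_card V)

theorem le_dim [Nontrivial R] {n k : ℕ} {V : Submodule R (Fin n → R)} {a : Fin k → Fin n → R}
    (ha : ∀ i, a i ∈ V) (hu : IsUnimodular a) : k ≤ dim V :=
  le_csSup (bddAbove_unimodular_card V) ⟨a, ha, hu⟩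

/-- A unimodular family of `m` vectors of an `m`-subspace spans it. -/
theorem IsSubspace.eq_range {n m : ℕ} {X : Submodule R (Fin n → R)} (hX : IsSubspace m X)
    {a : Fin m → Fin n → R} (ha : ∀ i, a i ∈ X) (hu : IsUnimodular a) :
    LinearMap.range (Matrix.of a).vecMulLinear = X := by
  obtain ⟨A, hA, rfl⟩ := isSubspace_iff.1 hX
  obtain ⟨C, hC⟩ := (mem_range_vecMulLinear_iff (X := Matrix.of a)).1 ha
  rw [← hC]
  exact range_vecMulLinear_mul (by rw [hC]; exact hu)

/-- If the intersection contained m = k + 1 unimodular vectors, these would span both subspaces and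
force X = Y. So for X ≠ Y its dimension is k as soon as it is at least k. -/
theorem eq_or_adj_iff [Nontrivial R] {n k : ℕ}
    {X Y : {X : Submodule R (Fin n → R) // IsSubspace (k + 1) X}} :
    (X = Y ∨ (grassmannGraph R n (k + 1)).Adj X Y) ↔
      ∃ a : Fin k → Fin n → R, (∀ i, a i ∈ X.1 ∧ a i ∈ Y.1) ∧ IsUnimodular a := by
  constructor
  · rintro (rfl | ⟨-, h⟩)
    · obtain ⟨a, -, h, hu⟩ := X.2
      refine ⟨_, fun i => ?_, hu.castLE k.le_succ⟩
      rw [and_self, ← h]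
      exact Submodule.subset_span ⟨_, rfl⟩
    · obtain ⟨a, ha, hu⟩ := exists_isUnimodular_dim (X.1 ⊓ Y.1)
      obtain h : dim (X.1 ⊓ Y.1) = k := Nat.succ_injective h
      exact ⟨_, fun i => ha (Fin.castLE h.ge i), hu.castLE h.ge⟩
  · rintro ⟨a, ha, hu⟩
    refine or_iff_not_imp_left.2 fun hne => ⟨hne, ?_⟩
    refine le_antisymm ?_ (Nat.succ_le_succ (le_dim ha hu))
    by_contra hlt
    obtain ⟨b, hb, hv⟩ := exists_isUnimodular_dim (X.1 ⊓ Y.1)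
    have hle : k + 1 ≤ dim (X.1 ⊓ Y.1) := by omega
    have hv' := hv.castLE hle
    exact hne (Subtype.ext ((X.2.eq_range (fun i => (hb _).1) hv').symm.trans
      (Y.2.eq_range (fun i => (hb _).2) hv')))

end Ring

/-! ### Lifting along a surjective local homomorphism onto a field -/

section Lift

variable {R K : Type*} [CommRing R] [Field K] {φ : R →+* K} {ι κ l : Type*} [Fintype ι]
  [Fintype κ] [DecidableEq ι] [DecidableEq l]

theorem exists_matrix_map_eq (hφ : Function.Surjective φ) (A : Matrix ι κ K) :
    ∃ B : Matrix ι κ R, B.map φ = A :=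
  ⟨Matrix.of fun i j => Function.surjInv hφ (A i j),
    by ext i j; exact Function.surjInv_eq hφ _⟩

theorem isUnit_of_isUnit_map [IsLocalHom φ] {A : Matrix ι ι R} (hA : IsUnit (A.map φ)) :
    IsUnit A := by
  rw [Matrix.isUnit_iff_isUnit_det] at hA ⊢
  rw [← RingHom.mapMatrix_apply, ← RingHom.map_det] at hA
  exact isUnit_of_map_unit φ _ hA

/-- A lift C of a right inverse makes A * C invertible over the field, hence invertible over R
because the determinant is a unit. -/
theorem hasRightInverse_map_iff [IsLocalHom φ] (hφ : Function.Surjective φ)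
    {A : Matrix ι κ R} : HasRightInverse (A.map φ) ↔ HasRightInverse A := by
  classical
  refine ⟨fun ⟨B, hB⟩ => ?_, HasRightInverse.map φ⟩
  obtain ⟨C, rfl⟩ := exists_matrix_map_eq hφ B
  obtain ⟨D, hD⟩ := (isUnit_of_isUnit_map (φ := φ) (A := A * C)
    (by rw [Matrix.map_mul, hB]; exact isUnit_one)).exists_right_inv
  exact ⟨C * D, by rw [← Matrix.mul_assoc, hD]⟩

theorem hasRightInverse_iff_linearIndependent_map [IsLocalHom φ] (hφ : Function.Surjective φ)
    {A : Matrix ι κ R} : HasRightInverse A ↔ LinearIndependent K (A.map φ).row := by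
  rw [← hasRightInverse_map_iff hφ, hasRightInverse_iff_linearIndependent]

/-- A matrix annihilated by `k` unimodular vectors of length `k + 1` is a product of a column
and a row, where the column is nonzero over the residue field. -/
theorem exists_eq_vecMulVec [IsLocalHom φ] (hφ : Function.Surjective φ) {k : ℕ}
    {X : Matrix (Fin k) (Fin (k + 1)) R} (hX : HasRightInverse X)
    {D : Matrix (Fin (k + 1)) κ R} (h : X * D = 0) :
    ∃ (u : Fin (k + 1) → R) (w : κ → R), φ ∘ u ≠ 0 ∧ D = vecMulVec u w := by
  -- X is completed by one row to an invertible square matrix Y with inverse Z. Then Y * D vanishes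
  -- outside its last row, so D = Z * (Y * D) is the last column of Z times that row.
  obtain ⟨x, hx⟩ := exists_linearIndependent_snoc_of_lt_finrank
    ((hasRightInverse_iff_linearIndependent_map hφ).1 hX) (by simp)
  obtain ⟨y, rfl⟩ := hφ.comp_left x
  let Y : Matrix (Fin (k + 1)) (Fin (k + 1)) R := Matrix.of (Fin.snoc (α := fun _ => _) X y)
  have hYc (i : Fin k) : Y i.castSucc = X i := Fin.snoc_castSucc (α := fun _ => _) _ _ i
  have hYl : Y (Fin.last k) = y := Fin.snoc_last (α := fun _ => _) _ _
  have hY : HasRightInverse Y := by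
    rw [hasRightInverse_iff_linearIndependent_map hφ]
    have hrow : (Y.map φ).row = Fin.snoc (α := fun _ => _) (X.map φ).row (φ ∘ y) := by
      funext i
      refine Fin.lastCases ?_ (fun i => ?_) i
      · rw [Fin.snoc_last]
        ext j
        simp [Matrix.row, hYl]
      · rw [Fin.snoc_castSucc]
        ext j
        simp [Matrix.row, hYc]
    rw [hrow]
    exact hx
  obtain ⟨Z, hZ⟩ := hY
  refine ⟨fun i => Z i (Fin.last k), (Y * D) (Fin.last k), fun h0 => ?_, ?_⟩
  · have h1 := congrFun (congrFun hZ (Fin.last k)) (Fin.last k)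
    rw [Matrix.mul_apply, Matrix.one_apply_eq] at h1
    apply_fun φ at h1
    rw [map_sum, map_one] at h1
    refine zero_ne_one (h1.symm.trans (Finset.sum_eq_zero fun i _ => ?_)).symm
    rw [map_mul, show φ (Z i (Fin.last k)) = 0 from congrFun h0 i, mul_zero]
  · calc D = Z * (Y * D) := by rw [← Matrix.mul_assoc, mul_eq_one_comm.1 hZ, Matrix.one_mul]
      _ = _ := by
        ext i j
        rw [Matrix.mul_apply, Fin.sum_univ_castSucc, vecMulVec_apply, add_eq_right]
        refine Finset.sum_eq_zero fun t _ => ?_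
        have : (Y * D) t.castSucc j = (X * D) t j := by
          simp [Matrix.mul_apply, hYc]
        rw [this, h, Matrix.zero_apply, mul_zero]

end Lift

/-! ### Counting unimodular families; the upper bound -/

section Count

variable {R K : Type*} [CommRing R] [Field K] {φ : R →+* K}

/-- A matrix with a right inverse amounts to a matrix with independent rows over the residue field
together with a correction with entries in the kernel. -/
noncomputable def hasRightInverseEquiv [IsLocalHom φ] (hφ : Function.Surjective φ) (k n : ℕ) :
    {A : Matrix (Fin k) (Fin n) R // HasRightInverse A} ≃
      {b : Fin k → Fin n → K // LinearIndependent K b} ×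
        (Fin k → Fin n → RingHom.ker φ) where
  toFun A := (⟨(A.1.map φ).row, (hasRightInverse_iff_linearIndependent_map hφ).1 A.2⟩,
    fun i j => ⟨A.1 i j - Function.surjInv hφ (φ (A.1 i j)), by
      rw [RingHom.mem_ker, map_sub, Function.surjInv_eq hφ, sub_self]⟩)
  invFun b := ⟨Matrix.of fun i j => Function.surjInv hφ (b.1.1 i j) + (b.2 i j : R), by
    rw [hasRightInverse_iff_linearIndependent_map hφ]
    convert b.1.2 using 1
    ext i j
    simp [Matrix.row, Function.surjInv_eq, RingHom.mem_ker.1 (b.2 i j).2]⟩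
  left_inv A := by
    ext i j
    simp [Matrix.row]
  right_inv b := by
    have h (i j) : φ (b.2 i j) = 0 := RingHom.mem_ker.1 (b.2 i j).2
    refine Prod.ext (Subtype.ext ?_) ?_
    · ext i j
      simp [Matrix.row, Function.surjInv_eq, h]
    · ext i j
      simp [Function.surjInv_eq, h]

theorem card_hasRightInverse [Fintype K] [IsLocalHom φ] (hφ : Function.Surjective φ) {k n : ℕ}
    (hk : k ≤ n) :
    Nat.card {A : Matrix (Fin k) (Fin n) R // HasRightInverse A} =
      (∏ i : Fin k, (Fintype.card K ^ n - Fintype.card K ^ (i : ℕ))) *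
        Nat.card (RingHom.ker φ) ^ (k * n) := by
  have h := card_linearIndependent (K := K) (V := Fin n → K) (k := k) (by simpa using hk)
  rw [Nat.card_congr (hasRightInverseEquiv hφ k n), Nat.card_prod, h, Nat.card_fun, Nat.card_fun,
    Nat.card_fin, Nat.card_fin, ← pow_mul, mul_comm n, Module.finrank_fin_fun]

/-- Double counting of the unimodular `k`-families in the members of an independent set. -/
theorem indepNum_mul_card_le [Finite R] [Nontrivial R] (n k : ℕ) :
    (grassmannGraph R n (k + 1)).indepNum *
        Nat.card {A : Matrix (Fin k) (Fin (k + 1)) R // HasRightInverse A} ≤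
      Nat.card {A : Matrix (Fin k) (Fin n) R // HasRightInverse A} := by
  obtain ⟨S, hS, hcard⟩ := (grassmannGraph R n (k + 1)).exists_isNIndepSet_indepNum
  have : Nat.card S = (grassmannGraph R n (k + 1)).indepNum := by
    rw [← hcard, Nat.card_eq_fintype_card, Fintype.card_coe]
  rw [← this, ← Nat.card_prod]
  choose A hA hr using fun X : {X : Submodule R (Fin n → R) // IsSubspace (k + 1) X} =>
    isSubspace_iff.1 X.2
  have : Finite (Matrix (Fin k) (Fin n) R) := inferInstanceAs (Finite (Fin k → Fin n → R))
  -- The pair (X, C) encodes the family C * A X inside X: independence of S recovers X, and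
  -- cancelling A X recovers C.
  refine Nat.card_le_card_of_injective
    (fun x => (⟨x.2.1 * A x.1, x.2.2.mul (hA _)⟩ :
      {A : Matrix (Fin k) (Fin n) R // HasRightInverse A})) ?_
  rintro ⟨X, C⟩ ⟨Y, D⟩ h
  have h' : C.1 * A X = D.1 * A Y := congrArg Subtype.val h
  obtain rfl : X = Y := by
    by_contra hne
    have hX : ∀ i, (C.1 * A X) i ∈ X.1.1 := by
      rw [← hr X.1]
      exact mem_range_vecMulLinear_iff.2 ⟨_, rfl⟩
    have hY : ∀ i, (C.1 * A X) i ∈ Y.1.1 := by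
      rw [← hr Y.1, h']
      exact mem_range_vecMulLinear_iff.2 ⟨_, rfl⟩
    rcases eq_or_adj_iff.2 ⟨C.1 * A X, fun i => ⟨hX i, hY i⟩, C.2.mul (hA _)⟩ with h0 | h0
    · exact hne (Subtype.ext h0)
    · exact hS X.2 Y.2 (fun h1 => hne (Subtype.ext h1)) h0
  exact Prod.ext rfl (Subtype.ext ((hA _).mul_right_cancel h'))

end Count

/-! ### Rank distance codes -/

section Code

variable {R K : Type*} [CommRing R] [Field K] {φ : R →+* K}

/-- Multiplication matrices of independent elements of a field extension. -/
theorem exists_matrices_isUnit_sum (L : Type*) [Field L] [Algebra K L] [FiniteDimensional K L]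
    {m N : ℕ} (hN : Module.finrank K L = N) (hm : m ≤ N) :
    ∃ M : Fin m → Matrix (Fin N) (Fin N) K,
      ∀ u : Fin m → K, u ≠ 0 → IsUnit (∑ i, u i • M i) := by
  let b := Module.finBasisOfFinrankEq K L hN
  refine ⟨fun i => Algebra.leftMulMatrix b (b (Fin.castLE hm i)), fun u hu => ?_⟩
  have h : ∑ i, u i • Algebra.leftMulMatrix b (b (Fin.castLE hm i)) =
      Algebra.leftMulMatrix b (∑ i, u i • b (Fin.castLE hm i)) := by simp
  rw [h]
  -- A nontrivial combination of basis elements is nonzero, hence a unit of the field L.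
  refine (IsUnit.mk0 _ fun h0 => hu ?_).map _
  exact funext (Fintype.linearIndependent_iff.1
    (b.linearIndependent.comp _ (Fin.castLE_injective hm)) u h0)

/-- A family of matrices with entries in the kernel of `φ`, no two of which are congruent on
`k` unimodular vectors. -/
theorem exists_code [IsLocalHom φ] (hφ : Function.Surjective φ) (L : Type*) [Field L] [Algebra K L]
    [FiniteDimensional K L] {k N : ℕ} (hN : Module.finrank K L = N) (hm : k + 1 ≤ N) :
    ∃ P : (Fin k → Fin N → RingHom.ker φ) → Matrix (Fin (k + 1)) (Fin N) R,
      (∀ c, (P c).map φ = 0) ∧ ∀ (c d) (X : Matrix (Fin k) (Fin (k + 1)) R),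
        HasRightInverse X → X * P c = X * P d → c = d := by
  obtain ⟨M', hM'⟩ := exists_matrices_isUnit_sum (K := K) L hN hm
  choose M hM using fun i => exists_matrix_map_eq hφ (M' i)
  have hunit (u : Fin (k + 1) → R) (hu : φ ∘ u ≠ 0) : IsUnit (∑ i, u i • M i) := by
    refine isUnit_of_isUnit_map (φ := φ) ?_
    convert hM' _ hu using 1
    ext a b
    simp [Matrix.sum_apply, ← hM]
  obtain ⟨T, hT⟩ := (show IsUnit (M 0) by
    simpa [Pi.single_apply, ite_smul] using hunit (Pi.single 0 1) fun h => by
      simpa using congrFun h 0).exists_left_inv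
  let v (c : Fin k → Fin N → RingHom.ker φ) (i : Fin k) : Fin N → R := fun j => c i j
  -- The code is cut out by the linear relation `hsum`: since M 0 is invertible with inverse T, rows
  -- 1 to k are free in ker φ and determine row 0.
  let P (c : Fin k → Fin N → RingHom.ker φ) : Matrix (Fin (k + 1)) (Fin N) R :=
    Matrix.of (Fin.cons (α := fun _ => _) (-((∑ i, v c i ᵥ* M i.succ) ᵥ* T)) (v c))
  have hP0 (c) : P c 0 = -((∑ i, v c i ᵥ* M i.succ) ᵥ* T) := rfl
  have hPs (c) (i : Fin k) : P c i.succ = v c i := rfl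
  have hv (c i j) : φ (v c i j) = 0 := RingHom.mem_ker.1 (c i j).2
  have hsum (c) : ∑ i, P c i ᵥ* M i = 0 := by
    simp [Fin.sum_univ_succ, hP0, hPs, Matrix.neg_vecMul, Matrix.vecMul_vecMul, hT]
  refine ⟨P, fun c => ?_, fun c d X hX h => ?_⟩
  · ext i j
    refine Fin.cases ?_ (fun i => ?_) i
    · simp [hP0, Matrix.vecMul, dotProduct, hv]
    · simp [hPs, hv]
  -- The difference of two codewords is a column u times a row w, so the relation becomes w * (∑ u i
  -- • M i) = 0 with an invertible sum; hence w = 0.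
  · obtain ⟨u, w, hu, huw⟩ := exists_eq_vecMulVec hφ hX (D := P c - P d)
      (by rw [Matrix.mul_sub, h, sub_self])
    have hrow (i) : P c i - P d i = u i • w := by
      ext j
      simpa [vecMulVec_apply] using congrFun (congrFun huw i) j
    have hw : w ᵥ* (∑ i, u i • M i) = 0 := by
      calc w ᵥ* (∑ i, u i • M i) = ∑ i, (P c i - P d i) ᵥ* M i := by
            simp [hrow, Matrix.vecMul_sum, Matrix.vecMul_smul, Matrix.smul_vecMul]
        _ = 0 := by simp [Matrix.sub_vecMul, hsum]
    obtain ⟨Z, hZ⟩ := (hunit u hu).exists_right_inv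
    have hw0 : w = 0 := by
      rw [← Matrix.vecMul_one w, ← hZ, ← Matrix.vecMul_vecMul, hw, Matrix.zero_vecMul]
    ext i j
    have := congrFun (hrow i.succ) j
    simpa [hPs, hw0, sub_eq_zero, v] using this

theorem exists_sum_linearIndependent {V : Type*} [AddCommGroup V] [Module K V]
    [FiniteDimensional K V] {m N : ℕ} {a : Fin m → V} (ha : LinearIndependent K a)
    (h : Module.finrank K V = m + N) :
    ∃ b : Fin N → V, LinearIndependent K (Sum.elim a b) := by
  obtain ⟨W, hW⟩ := (Submodule.span K (Set.range a)).exists_isCompl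
  have h1 := Submodule.finrank_add_eq_of_isCompl hW
  rw [finrank_span_eq_card ha, Fintype.card_fin, h, add_right_inj] at h1
  let b := Module.finBasisOfFinrankEq K W h1
  refine ⟨fun i => b i, ha.sum_type
    (b.linearIndependent.map' W.subtype W.ker_subtype) (hW.disjoint.mono_right ?_)⟩
  rw [Submodule.span_le]
  rintro _ ⟨i, rfl⟩
  exact (b i).2

/-! ### The lower bound: lifting an independent set -/

theorem card_ker_pow_mul_indepNum_le [Finite R] [Finite K] [IsLocalHom φ]
    (hφ : Function.Surjective φ) (L : Type*) [Field L] [Algebra K L] [FiniteDimensional K L]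
    {k N : ℕ} (hN : Module.finrank K L = N) (hm : k + 1 ≤ N) :
    Nat.card (RingHom.ker φ) ^ (k * N) * (grassmannGraph K (k + 1 + N) (k + 1)).indepNum ≤
      (grassmannGraph R (k + 1 + N) (k + 1)).indepNum := by
  classical
  have : Nontrivial R := φ.domain_nontrivial
  obtain ⟨P, hP, hPinj⟩ := exists_code hφ L hN hm
  obtain ⟨S, hS, hcard⟩ := (grassmannGraph K (k + 1 + N) (k + 1)).exists_isNIndepSet_indepNum
  choose A' hA' hr using
    fun X : {X : Submodule K (Fin (k + 1 + N) → K) // IsSubspace (k + 1) X} =>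
      isSubspace_iff.1 X.2
  choose B' hB' using fun X =>
    exists_sum_linearIndependent (hA' X).linearIndependent (N := N) (by simp)
  choose A hA using fun X => exists_matrix_map_eq hφ (A' X)
  choose B hB using fun X => exists_matrix_map_eq hφ (Matrix.of (B' X))
  have hG (X) : HasRightInverse (Matrix.fromRows (A X) (B X)) := by
    rw [hasRightInverse_iff_linearIndependent_map hφ]
    have hrow : ((Matrix.fromRows (A X) (B X)).map φ).row = Sum.elim (A' X).row (B' X) := by
      ext (i | i) j
      · exact congrFun (congrFun (hA X) i) j
      · exact congrFun (congrFun (hB X) i) j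
    rw [hrow]
    exact hB' X
  let F (X : {X : Submodule K (Fin (k + 1 + N) → K) // IsSubspace (k + 1) X})
      (c : Fin k → Fin N → RingHom.ker φ) := A X + P c * B X
  have hFmap (X c) : (F X c).map φ = A' X := by
    rw [Matrix.map_add φ (map_add φ), Matrix.map_mul, hP, Matrix.zero_mul, add_zero, hA]
  have hF (X c) : HasRightInverse (F X c) := by
    rw [← hasRightInverse_map_iff hφ, hFmap]
    exact hA' X
  let V (x : S × (Fin k → Fin N → RingHom.ker φ)) :
      {X : Submodule R (Fin (k + 1 + N) → R) // IsSubspace (k + 1) X} :=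
    ⟨LinearMap.range (F x.1 x.2).vecMulLinear, isSubspace_iff.2 ⟨_, hF _ _, rfl⟩⟩
  have key (x y) (h : V x = V y ∨ (grassmannGraph R (k + 1 + N) (k + 1)).Adj (V x) (V y)) :
      x = y := by
    obtain ⟨z, hz, hu⟩ := eq_or_adj_iff.1 h
    obtain ⟨C, hC⟩ := (mem_range_vecMulLinear_iff (X := Matrix.of z)).1 fun i => (hz i).1
    obtain ⟨D, hD⟩ := (mem_range_vecMulLinear_iff (X := Matrix.of z)).1 fun i => (hz i).2
    obtain ⟨⟨X, hX⟩, c⟩ := x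
    obtain ⟨⟨Y, hY⟩, d⟩ := y
    dsimp only at hC hD
    have hu' : HasRightInverse (Matrix.of z) := hu
    -- Every lift reduces to its original member, so the common family reduces to a unimodular
    -- family common to X and Y.
    obtain rfl : X = Y := by
      by_contra hne
      have hCm : (Matrix.of z).map φ = C.map φ * A' X := by
        rw [← hC, Matrix.map_mul, hFmap]
      have hDm : (Matrix.of z).map φ = D.map φ * A' Y := by
        rw [← hD, Matrix.map_mul, hFmap]
      refine (eq_or_adj_iff.2 ⟨(Matrix.of z).map φ, fun i => ⟨?_, ?_⟩, hu'.map φ⟩).elim hne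
        (hS hX hY hne)
      · rw [← hr X]
        exact mem_range_vecMulLinear_iff.2 ⟨_, hCm.symm⟩ i
      · rw [← hr Y]
        exact mem_range_vecMulLinear_iff.2 ⟨_, hDm.symm⟩ i
    have hexp (C : Matrix (Fin k) (Fin (k + 1)) R) (c) : C * F X c = Matrix.fromCols C (C * P c) * Matrix.fromRows (A X) (B X) := by
      rw [Matrix.fromCols_mul_fromRows, Matrix.mul_add, Matrix.mul_assoc]
    -- Cancelling the stacked matrix of A X and B X leaves [C | C * P c] = [D | D * P d]; thus C =
    -- D, and the code property applies.
    have h1 := (hG X).mul_right_cancel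
      ((hexp C c).symm.trans ((hC.trans hD.symm).trans (hexp D d)))
    obtain ⟨rfl, h2⟩ := Matrix.fromCols_inj h1
    rw [hPinj c d C (by rw [← hC] at hu'; exact hu'.of_mul) h2]
  have hinj : Function.Injective V := fun x y h => key x y (Or.inl h)
  have := Fintype.ofFinite (S × (Fin k → Fin N → RingHom.ker φ))
  have hle := SimpleGraph.IsIndepSet.card_le_indepNum
    (G := grassmannGraph R (k + 1 + N) (k + 1)) (t := Finset.univ.image V) (by
      intro X hX Y hY hne hadj
      obtain ⟨x, -, rfl⟩ := Finset.mem_image.1 (Finset.mem_coe.1 hX)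
      obtain ⟨y, -, rfl⟩ := Finset.mem_image.1 (Finset.mem_coe.1 hY)
      exact hne (congrArg V (key x y (Or.inr hadj))))
  rw [Finset.card_image_of_injective _ hinj, Finset.card_univ, ← Nat.card_eq_fintype_card,
    Nat.card_prod, Nat.card_fun, Nat.card_fun, Nat.card_fin, Nat.card_fin, ← pow_mul,
    Nat.card_eq_fintype_card (α := S), Fintype.card_coe, hcard] at hle
  rwa [mul_comm k, mul_comm]

end Code

/-! ### Residue rings of the integers -/

theorem isLocalHom_castHom {p s : ℕ} (hp : p.Prime) (hs : s ≠ 0) :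
    IsLocalHom (ZMod.castHom (dvd_pow_self p hs) (ZMod p)) := by
  have : NeZero (p ^ s) := ⟨pow_ne_zero s hp.ne_zero⟩
  refine ⟨fun a ha => ?_⟩
  obtain ⟨a, rfl⟩ := ZMod.natCast_zmod_surjective a
  rw [map_natCast, ZMod.isUnit_iff_coprime] at ha
  rw [ZMod.isUnit_iff_coprime]
  exact ha.pow_right s

theorem card_ker_castHom {p s : ℕ} (hp : p.Prime) (hs : s ≠ 0) :
    Nat.card (RingHom.ker (ZMod.castHom (dvd_pow_self p hs) (ZMod p))) = p ^ (s - 1) := by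
  set φ := ZMod.castHom (dvd_pow_self p hs) (ZMod p)
  have h := AddSubgroup.card_eq_card_quotient_mul_card_addSubgroup φ.toAddMonoidHom.ker
  rw [Nat.card_congr (QuotientAddGroup.quotientKerEquivOfSurjective φ.toAddMonoidHom
    (ZMod.castHom_surjective (dvd_pow_self p hs))).toEquiv, Nat.card_zmod, Nat.card_zmod] at h
  obtain ⟨t, rfl⟩ := Nat.exists_eq_succ_of_ne_zero hs
  exact (Nat.eq_of_mul_eq_mul_left hp.pos ((pow_succ' p t).symm.trans h)).symm

/-- The right side is the ratio of the numbers of independent k-tuples in K^n and in K^(k+1) with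
|K| = q, the form in which the double count delivers the bound. -/
theorem gaussBinom_div_gaussBinom_one {q n k : ℕ} (hq : 2 ≤ q) (hk : k + 1 ≤ n) :
    gaussBinom q n (k + 1) / gaussBinom q (n - (k + 1) + 1) 1 =
      ∏ i ∈ Finset.range k, (((q : ℚ) ^ n - q ^ i) / ((q : ℚ) ^ (k + 1) - q ^ i)) := by
  have hq1 : (1 : ℚ) < q := by exact_mod_cast hq
  have hne {j : ℕ} (hj : j ≠ 0) : (q : ℚ) ^ j - 1 ≠ 0 :=
    sub_ne_zero.2 (one_lt_pow₀ hq1 hj).ne'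
  have hfac {a i : ℕ} (h : i ≤ a) : (q : ℚ) ^ a - q ^ i = q ^ i * (q ^ (a - i) - 1) := by
    rw [mul_sub, ← pow_add, Nat.add_sub_cancel' h, mul_one]
  have h1 : gaussBinom q n (k + 1) =
      (∏ i ∈ Finset.range (k + 1), ((q : ℚ) ^ (n - i) - 1)) /
        ∏ i ∈ Finset.range (k + 1), ((q : ℚ) ^ (i + 1) - 1) := by
    rw [gaussBinom, ← Finset.Ico_add_one_right_eq_Icc, Finset.prod_Ico_eq_prod_range,
      Finset.prod_div_distrib]
    congr 1
    · refine Finset.prod_congr rfl fun i _ => ?_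
      congr 2
      omega
    · exact Finset.prod_congr rfl fun i _ => by rw [add_comm]
  have h2 : gaussBinom q (n - (k + 1) + 1) 1 = ((q : ℚ) ^ (n - k) - 1) / (q - 1) := by
    rw [gaussBinom, Finset.Icc_self, Finset.prod_singleton, pow_one]
    congr 3
    omega
  have h3 : ∏ i ∈ Finset.range k, (((q : ℚ) ^ n - q ^ i) / ((q : ℚ) ^ (k + 1) - q ^ i)) =
      (∏ i ∈ Finset.range k, ((q : ℚ) ^ (n - i) - 1)) /
        ∏ i ∈ Finset.range k, ((q : ℚ) ^ (i + 1 + 1) - 1) := by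
    -- Once q^i is cancelled, the denominators have exponents descending from k + 1 to 2; reversing
    -- the product aligns the factors.
    rw [← Finset.prod_range_reflect (fun i => (q : ℚ) ^ (i + 1 + 1) - 1),
      ← Finset.prod_div_distrib]
    refine Finset.prod_congr rfl fun i hi => ?_
    have hi := Finset.mem_range.1 hi
    rw [hfac (show i ≤ n by omega), hfac (show i ≤ k + 1 by omega),
      mul_div_mul_left _ _ (pow_ne_zero _ (by positivity))]
    congr 3
    omega
  rw [h1, h2, h3, Finset.prod_range_succ, Finset.prod_range_succ' (fun i => (q : ℚ) ^ (i + 1) - 1)]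
  have h4 : (∏ i ∈ Finset.range k, ((q : ℚ) ^ (i + 1 + 1) - 1)) ≠ 0 :=
    Finset.prod_ne_zero_iff.2 fun i _ => hne (by omega)
  have h5 := hne (j := n - k) (by omega)
  have h6 : (q : ℚ) - 1 ≠ 0 := by simpa using hne (j := 1) one_ne_zero
  rw [zero_add, pow_one]
  field_simp

/-- An inequality between the numbers of unimodular families, solved for the first factor. -/
theorem le_pow_mul_prod_div_of_mul_le {q e n k a : ℕ} (hq : 2 ≤ q) (he : e ≠ 0) (hk : k + 1 ≤ n)
    (h : a * ((∏ i : Fin k, (q ^ (k + 1) - q ^ (i : ℕ))) * e ^ (k * (k + 1))) ≤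
      (∏ i : Fin k, (q ^ n - q ^ (i : ℕ))) * e ^ (k * n)) :
    (a : ℚ) ≤ (e : ℚ) ^ (k * (n - (k + 1))) *
      ∏ i ∈ Finset.range k, (((q : ℚ) ^ n - q ^ i) / ((q : ℚ) ^ (k + 1) - q ^ i)) := by
  have hq1 : (1 : ℚ) < q := by exact_mod_cast hq
  have hcast {N : ℕ} (hN : k ≤ N) : ((∏ i : Fin k, (q ^ N - q ^ (i : ℕ)) : ℕ) : ℚ) =
      ∏ i ∈ Finset.range k, ((q : ℚ) ^ N - q ^ i) := by
    rw [Finset.prod_range, Nat.cast_prod]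
    refine Finset.prod_congr rfl fun i _ => ?_
    rw [Nat.cast_sub (Nat.pow_le_pow_right (by omega) (by omega))]
    push_cast
    rfl
  have h' : (a : ℚ) * ((∏ i ∈ Finset.range k, ((q : ℚ) ^ (k + 1) - q ^ i)) *
      (e : ℚ) ^ (k * (k + 1))) ≤
      (∏ i ∈ Finset.range k, ((q : ℚ) ^ n - q ^ i)) * (e : ℚ) ^ (k * n) := by
    rw [← hcast (show k ≤ k + 1 by omega), ← hcast (show k ≤ n by omega)]
    exact_mod_cast h
  have hpos : 0 < ∏ i ∈ Finset.range k, ((q : ℚ) ^ (k + 1) - q ^ i) :=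
    Finset.prod_pos fun i hi => sub_pos.2 <| pow_lt_pow_right₀ hq1 <| by
      have := Finset.mem_range.1 hi
      omega
  have he' : (0 : ℚ) < (e : ℚ) ^ (k * (k + 1)) := by positivity
  have hsplit : (e : ℚ) ^ (k * n) = (e : ℚ) ^ (k * (n - (k + 1))) * (e : ℚ) ^ (k * (k + 1)) := by
    rw [← pow_add, ← mul_add, Nat.sub_add_cancel hk]
  rw [hsplit, ← mul_assoc, ← mul_assoc] at h'
  rw [Finset.prod_div_distrib, ← mul_div_assoc, le_div_iff₀ hpos, mul_comm ((e : ℚ) ^ _)]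
  exact le_of_mul_le_mul_right h' he'

end GrassmannRing

theorem theorem4p5 (p s m n : ℕ) (hp : p.Prime) (hs : 1 ≤ s) (hm : 1 ≤ m) (hn : 2 * m ≤ n) :
    p ^ ((s - 1) * (m - 1) * (n - m)) *
        (GrassmannRing.grassmannGraph (ZMod p) n m).indepNum
      ≤ (GrassmannRing.grassmannGraph (ZMod (p ^ s)) n m).indepNum ∧
    ((GrassmannRing.grassmannGraph (ZMod (p ^ s)) n m).indepNum : ℚ)
      ≤ (p : ℚ) ^ ((s - 1) * (m - 1) * (n - m)) *
        (GrassmannRing.gaussBinom p n m / GrassmannRing.gaussBinom p (n - m + 1) 1) := by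
  have hs0 : s ≠ 0 := by omega
  have : Fact p.Prime := ⟨hp⟩
  have : NeZero (p ^ s) := ⟨pow_ne_zero s hp.ne_zero⟩
  have : Fact (1 < p ^ s) := ⟨Nat.one_lt_pow hs0 hp.one_lt⟩
  have hloc := GrassmannRing.isLocalHom_castHom hp hs0
  have hcard := GrassmannRing.card_ker_castHom hp hs0
  have hsurj := ZMod.castHom_surjective (dvd_pow_self p hs0)
  obtain ⟨k, rfl⟩ := Nat.exists_eq_add_of_le' hm
  obtain ⟨N, rfl⟩ := Nat.exists_eq_add_of_le (show k + 1 ≤ n by omega)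
  rw [Nat.add_sub_cancel, mul_assoc (s - 1), pow_mul p, pow_mul (p : ℚ), ← Nat.cast_pow p (s - 1),
    ← hcard]
  constructor
  · rw [Nat.add_sub_cancel_left]
    -- The field with p^N elements serves as the degree N extension, and n ≥ 2m becomes k + 1 ≤ N.
    exact GrassmannRing.card_ker_pow_mul_indepNum_le hsurj (GaloisField p N)
      (GaloisField.finrank p (by omega)) (by omega)
  · rw [GrassmannRing.gaussBinom_div_gaussBinom_one hp.two_le (by omega)]
    refine GrassmannRing.le_pow_mul_prod_div_of_mul_le (n := k + 1 + N) hp.two_le Nat.card_pos.ne' (by omega) ?_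
    have h := GrassmannRing.indepNum_mul_card_le (R := ZMod (p ^ s)) (k + 1 + N) k
    rwa [GrassmannRing.card_hasRightInverse hsurj (by omega),
      GrassmannRing.card_hasRightInverse hsurj (by omega), ZMod.card] at h
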